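/- Let $n\ge 0$ and let $W=S_n^B$ be the group of signed permutations acting on $\mathbb R^n$, with simple reflections $s_1,\dots,s_{n-1}$ (exchanging the coordinates $i$ and $i+1$) and $s_n$ (changing the sign of the last coordinate). Let $W_I=\langle s_1,\dots,s_{n-1}\rangle$. For $B=uW_I\in W/W_I$ put $\delta_B=u\cdot\frac12(1,\dots,1)$; this identifies $W/W_I$ with $\{(\pm\frac12,\dots,\pm\frac12)\}$, hence (taking the set of positive coordinates) with the set of subsets of $[n]=\{1,\dots,n\}$. Let $|\delta_B|$ be the coordinate sum of $\delta_B$. Let $\le$ be the Bruhat order on $W$; on $W/W_I$ write $B\le B'$ if $u\le u'$ for some $u\in B$, $u'\in B'$; and for $w\in W$ write $B\le^w B'$ if $w^{-1}B\le w^{-1}B'$. A delta-matroid is a subset $M\subseteq W/W_I$ that has, for every $w\in W$, a unique $\le^w$-minimal element, denoted $\min^w(M)$. Its base polytope is $P_M=\operatorname{Conv}(\delta_B\mid B\in M)$, its $\mathcal G$-invariant is $\mathcal G(M)=\sum_{w\in W}U_{w^{-1}\min^w(M)}\in\mathbb Q^{W/W_I}$, where $(U_B)_{B\in W/W_I}$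 is the standard basis, and its interlace polynomial is $$q_M(x)=\sum_{A\subseteq[n]}x^{d_M(A)},\qquad d_M(A)=\min\{|(B\setminus A)\cup(A\setminus B)| : B\in M\},$$ where the elements of $M$ are regarded as subsets of $[n]$. Theorem. For every $B\in W/W_I$ the number $\frac n2-|\delta_B|$ is a nonnegative integer, and for every delta-matroid $M$ $$q_M(x)=\frac1{n!}\sum_{w\in S_n^B}x^{\frac n2-|\delta_{w^{-1}\min^w(M)}|}.$$ Hence the interlace polynomial is a specialization of the $\mathcal G$-invariant: the $\mathbb Q$-linear map $\psi:\mathbb Q^{W/W_I}\to\mathbb Q[x]$ with $\psi(U_B)=\frac1{n!}x^{\frac n2-|\delta_B|}$ satisfies $\psi(\mathcal G(M))=q_M$ for every delta-matroid $M$. Moreover, the interlace polynomial is a valuative invariant of delta-matroids: for all delta-matroids $M_1,\dots,M_k$ and integers $a_1,\dots,a_k$ such that the indicator functions of the base polytopes satisfy $\sum_i a_i\mathbf 1_{P_{M_i}}=0$, one has $\sum_i a_i q_{M_i}=0$; and the family of base polytopes of delta-matroids is stable under $W$, with $q_{M'}=q_M$ whenever $w\in W$ and $P_{M'}=w\cdot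 P_M$. -/

import Mathlib

open Polynomial

noncomputable section

/-! ## Coxeter matroids of a group `W` generated by a set `S` of simple reflections -/

namespace Cox

/-- The length of `w`: the least length of a word in the simple reflections with product `w`. -/
def length {W : Type*} [Group W] (S : Set W) (w : W) : ℕ :=
  sInf {k | ∃ l : List W, (∀ s ∈ l, s ∈ S) ∧ l.prod = w ∧ l.length = k}

/-- The reflections: all conjugates of simple reflections. -/
def reflections {W : Type*} [Group W] (S : Set W) : Set W :=
  {t | ∃ g : W, ∃ s ∈ S, t = g * s * g⁻¹}

/-- The Bruhat order on `W`: the reflexive transitive closure of the relation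
`u < u t` for `t` a reflection with `ℓ(u) < ℓ(u t)`. -/
def BruhatLE {W : Type*} [Group W] (S : Set W) : W → W → Prop :=
  Relation.ReflTransGen fun u v => ∃ t ∈ reflections S, v = u * t ∧ length S u < length S v

/-- The cosets `W / W_I` of the parabolic subgroup `W_I` generated by a set `J ⊆ S` of
simple reflections. -/
abbrev Cosets {W : Type*} [Group W] (J : Set W) : Type _ := W ⧸ Subgroup.closure J

/-- The Bruhat order on `W / W_I`. -/
def CosetLE {W : Type*} [Group W] (S J : Set W) (B B' : Cosets J) : Prop :=
  ∃ u u' : W, (u : Cosets J) = B ∧ (u' : Cosets J) = B' ∧ BruhatLE S u u'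

/-- The `w`-shifted Bruhat order: `B ≤^w B'` means `w⁻¹ B ≤ w⁻¹ B'`. -/
def ShiftedLE {W : Type*} [Group W] (S J : Set W) (w : W) (B B' : Cosets J) : Prop :=
  CosetLE S J (w⁻¹ • B) (w⁻¹ • B')

/-- `B` is a `≤^w`-minimal element of `M`. -/
def IsMinimalIn {W : Type*} [Group W] (S J : Set W) (w : W) (M : Set (Cosets J))
    (B : Cosets J) : Prop :=
  B ∈ M ∧ ∀ B' ∈ M, ShiftedLE S J w B' B → B' = B

/-- Coxeter matroids: subsets `M` of `W / W_I` which have, for every `w ∈ W`, a unique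
`≤^w`-minimal element. -/
def IsCoxeterMatroid {W : Type*} [Group W] (S J : Set W) (M : Set (Cosets J)) : Prop :=
  ∀ w : W, ∃! B, IsMinimalIn S J w M B

/-- The type of all Coxeter matroids. -/
def Matroid {W : Type*} [Group W] (S J : Set W) : Type _ :=
  {M : Set (Cosets J) // IsCoxeterMatroid S J M}

/-- `min^w(M)`, the unique `≤^w`-minimal element of `M`. -/
def minBasis {W : Type*} [Group W] {S J : Set W} (M : Matroid S J) (w : W) : Cosets J :=
  (M.2 w).choose

open Classical in
/-- The standard basis vector `U_B` of `ℚ^{W / W_I}`. -/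
def U {W : Type*} [Group W] {J : Set W} (B : Cosets J) : Cosets J → ℚ := Pi.single B 1

/-- The `𝒢`-invariant `𝒢(M) = ∑_{w ∈ W} U_{w⁻¹ min^w(M)}`. -/
def GInvariant {W : Type*} [Group W] [Fintype W] {S J : Set W} (M : Matroid S J) :
    Cosets J → ℚ :=
  ∑ w : W, U (w⁻¹ • minBasis M w)

end Cox

/-! ## Valuative functions and valuative invariants -/

/-- A function `f` on a family `P` of subsets of `V` (indexed by `ι`) is valuative if every
integral linear relation between the indicator functions of members of the family is also
satisfied by the values of `f`. -/
def IsValuative {ι V A : Type*} [AddCommGroup A] (P : ι → Set V) (f : ι → A) : Prop :=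
  ∀ (s : Finset ι) (a : ι → ℤ),
    (∑ i ∈ s, a i • (P i).indicator (fun _ => (1 : ℤ))) = 0 → ∑ i ∈ s, a i • f i = 0

/-- A function `f` on a family `P` of subsets of `V` is a valuative invariant, for an action of
`W` on `V`, if the family is stable under `W` and `f` is valuative with `f (w • P) = f P`. -/
def IsValuativeInvariant (W : Type*) {ι V A : Type*} [Group W] [MulAction W V] [AddCommGroup A]
    (P : ι → Set V) (f : ι → A) : Prop :=
  IsValuative P f ∧
  (∀ (w : W) (i : ι), ∃ j, P j = (fun v => w • v) '' P i) ∧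
  (∀ (w : W) (i j : ι), P j = (fun v => w • v) '' P i → f j = f i)

/-! ## Type `B` -/

/-- The signed permutation group `S_n^B`; the element `(ε, σ)` is the signed permutation
`e_j ↦ ε (σ j) e_{σ j}`. -/
abbrev SignedPerm (n : ℕ) : Type :=
  (Fin n → ℤˣ) ⋊[mulAutArrow] Equiv.Perm (Fin n)

namespace SignedPerm

instance instFintype (n : ℕ) : Fintype (SignedPerm n) :=
  Fintype.ofEquiv _ SemidirectProduct.equivProd.symm

/-- The action of `S_n^B` on `ℝ^n` by signed permutations of the coordinates. -/
instance instMulAction (n : ℕ) : MulAction (SignedPerm n) (Fin n → ℝ) where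
  smul w v := fun i => (((w.left i : ℤˣ) : ℤ) : ℝ) * v (w.right⁻¹ i)
  one_smul v := by
    funext i
    change (((1 : ℤˣ) : ℤ) : ℝ) * v ((1 : Equiv.Perm (Fin n))⁻¹ i) = v i
    simp
  mul_smul w w' v := by
    funext i
    change (((w.left i * w'.left (w.right⁻¹ i) : ℤˣ) : ℤ) : ℝ) * v ((w.right * w'.right)⁻¹ i) =
      ((w.left i : ℤ) : ℝ) * (((w'.left (w.right⁻¹ i) : ℤ) : ℝ) * v (w'.right⁻¹ (w.right⁻¹ i)))
    simp [mul_assoc]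

theorem smul_apply {n : ℕ} (w : SignedPerm n) (v : Fin n → ℝ) (i : Fin n) :
    (w • v) i = (((w.left i : ℤˣ) : ℤ) : ℝ) * v (w.right⁻¹ i) := rfl

/-- The adjacent transpositions, i.e. the simple reflections in the roots `e_i - e_{i+1}`. -/
def adjacentSwaps (n : ℕ) : Set (SignedPerm n) :=
  {s | ∃ i j : Fin n, (i : ℕ) + 1 = j ∧ s = SemidirectProduct.inr (Equiv.swap i j)}

/-- The simple reflections of type `B_n`: those in the roots `e_i - e_{i+1}`, and the one in the
last coordinate vector `e_n`. -/
def simpleReflections (n : ℕ) : Set (SignedPerm n) :=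
  adjacentSwaps n ∪
    {s | ∃ i : Fin n, (i : ℕ) + 1 = n ∧ s = SemidirectProduct.inl (Pi.mulSingle i (-1))}

/-- The fundamental weight `ϖ_n = (1/2, …, 1/2)`. -/
def weight (n : ℕ) : Fin n → ℝ := fun _ => 1 / 2

theorem smul_weight {n : ℕ} {w : SignedPerm n} (hw : w ∈ Subgroup.closure (adjacentSwaps n)) :
    w • weight n = weight n := by
  have h : Subgroup.closure (adjacentSwaps n) ≤ MulAction.stabilizer _ (weight n) := by
    rw [Subgroup.closure_le]
    rintro _ ⟨i, j, _, rfl⟩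
    funext k
    simp [smul_apply, weight]
  exact h hw

end SignedPerm

/-- Delta-matroids on `[n]`: the Coxeter matroids of type `B_n` whose parabolic subgroup `W_I`
is generated by all the simple reflections but the one in `e_n`, so that `W / W_I` is identified
with the orbit `{(±1/2, …, ±1/2)}` of the fundamental weight `ϖ_n`. -/
abbrev DeltaMatroid (n : ℕ) : Type :=
  Cox.Matroid (SignedPerm.simpleReflections n) (SignedPerm.adjacentSwaps n)

namespace DeltaMatroid

/-- The set `W / W_I = (ℤ/2)^n`. -/
abbrev Basis (n : ℕ) : Type := Cox.Cosets (SignedPerm.adjacentSwaps n)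

/-- The point `δ_B = u • ϖ_n` for any `u ∈ B`. -/
def delta {n : ℕ} (B : Basis n) : Fin n → ℝ :=
  Quotient.liftOn' B (fun u => u • SignedPerm.weight n) (by
    intro u v h
    have h1 := SignedPerm.smul_weight (QuotientGroup.leftRel_apply.mp h)
    change u • SignedPerm.weight n = v • SignedPerm.weight n
    rw [mul_smul, inv_smul_eq_iff] at h1
    exact h1.symm)

/-- The base polytope `P_M = Conv(δ_B | B ∈ M)`. -/
def basePolytope {n : ℕ} (M : DeltaMatroid n) : Set (Fin n → ℝ) :=
  convexHull ℝ (delta '' M.1)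

/-- The subset of `[n]` corresponding to `B`: the set of positive coordinates of `δ_B`. -/
def posSet {n : ℕ} (B : Basis n) : Finset (Fin n) :=
  Finset.univ.filter fun i => 0 < delta B i

/-- `d_M(A)`, the least size of the symmetric difference of `A` and a member of `M`
(a delta-matroid is nonempty). -/
def dist {n : ℕ} (M : DeltaMatroid n) (A : Finset (Fin n)) : ℕ :=
  sInf {k | ∃ B ∈ M.1, k = ((posSet B \ A) ∪ (A \ posSet B)).card}

/-- The interlace polynomial `q_M(x) = ∑_{A ⊆ [n]} x^{d_M(A)}`. -/
def interlace {n : ℕ} (M : DeltaMatroid n) : ℚ[X] :=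
  ∑ A : Finset (Fin n), X ^ dist M A

end DeltaMatroid

end

/-! Right multiplication of `u` by a reflection that increases length subtracts from `u • weight n`
a nonnegative multiple of a positive root, and positive roots have nonnegative coordinate sum. So
n/2 - |δ_B|, the number of negative coordinates of δ_B (`defect`), is monotone for the Bruhat order
on W/W_I, and min^w(M) minimises `defect (w⁻¹ • B)` over M (`defect_minBasis_le`). This number is
the size of the symmetric difference of B and A = `posSet w` (`card_symmDiff_posSet`), so the
exponent at w is d_M(A). Each A comes from n! elements w, whence the formula.

For fixed w the same number is an affine function of δ_B, so its minimum over M is at most k exactly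
when P_M meets a certain closed half-space (`basePolytope_inter_nonempty`). The Euler characteristic
of compact convex sets (`sum_nonempty_eq_zero`) turns a relation between indicator functions into
one between these conditions, hence between the coefficients of q_M. Invariance holds because W
permutes the half-spaces. -/

/-! ### Euler characteristic of compact convex sets -/

/-- An integral relation between the indicator functions of compact convex subsets of the line is
satisfied by the function that is `1` on nonempty sets. -/
theorem sum_nonempty_eq_zero_of_real {ι : Type*} (s : Finset ι) (a : ι → ℤ) (K : ι → Set ℝ)
    (hc : ∀ i ∈ s, IsCompact (K i)) (hv : ∀ i ∈ s, Convex ℝ (K i))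
    (h : ∀ t, ∑ i ∈ s, a i * (K i).indicator 1 t = 0) :
    open Classical in ∑ i ∈ s, (if (K i).Nonempty then a i else 0) = 0 := by
  classical
  rw [← Finset.sum_filter]
  set T := s.filter fun i => (K i).Nonempty with hT
  have hmax : ∀ i ∈ T, sSup (K i) ∈ K i ∧ ∀ x ∈ K i, x ≤ sSup (K i) := by
    intro i hi
    rw [hT, Finset.mem_filter] at hi
    exact ⟨(hc i hi.1).sSup_mem hi.2, fun x hx => le_csSup (hc i hi.1).bddAbove hx⟩
  have hK : ∀ t, ∑ i ∈ T, (if t ∈ K i then a i else 0) = 0 := by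
    intro t
    rw [hT, Finset.sum_filter]
    refine Eq.trans ?_ (h t)
    refine Finset.sum_congr rfl fun i _ => ?_
    by_cases hi : t ∈ K i
    · rw [if_pos ⟨t, hi⟩]; simp [hi]
    · simp [hi]
  -- Group the intervals by right endpoint x. Passing from x to a nearby y > x, the indicator of an
  -- interval drops exactly when x is its right endpoint.
  rw [← Finset.sum_fiberwise_of_maps_to (g := fun i => sSup (K i))
    (fun i hi => Finset.mem_image_of_mem (fun i => sSup (K i)) hi)]
  refine Finset.sum_eq_zero fun x _ => ?_
  have hev : ∀ᶠ y in nhdsWithin x (Set.Ioi x), ∀ i ∈ T,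
      ((if x ∈ K i then a i else 0) - (if y ∈ K i then a i else 0) : ℤ) =
        if sSup (K i) = x then a i else 0 := by
    rw [Filter.eventually_all_finset]
    intro i hi
    obtain ⟨h1, h2⟩ := hmax i hi
    have hi' := (Finset.mem_filter.mp hi).1
    by_cases hx : x ∈ K i
    · rcases (h2 x hx).eq_or_lt with hxe | hlt
      · filter_upwards [self_mem_nhdsWithin] with y hy
        have : y ∉ K i := fun hyK => absurd (h2 y hyK) (by rw [← hxe]; exact not_le.mpr hy)
        rw [if_pos hx, if_neg this, if_pos hxe.symm, sub_zero]
      · filter_upwards [Ioo_mem_nhdsGT hlt] with y hy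
        have : y ∈ K i := (hv i hi').ordConnected.out hx h1 ⟨hy.1.le, hy.2.le⟩
        rw [if_pos hx, if_pos this, if_neg hlt.ne', sub_self]
    · have hne : sSup (K i) ≠ x := fun he => hx (he ▸ h1)
      have ho := (hc i hi').isClosed.isOpen_compl.mem_nhds (show x ∈ (K i)ᶜ from hx)
      filter_upwards [mem_nhdsWithin_of_mem_nhds ho] with y hy
      rw [if_neg hx, if_neg hy, if_neg hne, sub_zero]
  obtain ⟨y, hy⟩ := hev.exists
  rw [Finset.sum_filter, ← Finset.sum_congr rfl hy, Finset.sum_sub_distrib, hK, hK, sub_zero]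

/-- An integral relation between the indicator functions of compact convex subsets of `ℝ^n` is
satisfied by the function that is `1` on nonempty sets (the Euler characteristic). -/
theorem sum_nonempty_eq_zero {ι κ : Type*} [Fintype κ] (s : Finset ι) (a : ι → ℤ)
    (K : ι → Set (κ → ℝ))
    (hc : ∀ i ∈ s, IsCompact (K i)) (hv : ∀ i ∈ s, Convex ℝ (K i))
    (h : ∀ x, ∑ i ∈ s, a i * (K i).indicator 1 x = 0) :
    open Classical in ∑ i ∈ s, (if (K i).Nonempty then a i else 0) = 0 := by
  classical
  -- Induction on the set `F` of free coordinates of a slice: the empty set is the pointwise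
  -- hypothesis, the full set is the claim.
  suffices H : ∀ (F : Finset κ) (c : κ → ℝ),
      ∑ i ∈ s, (if (K i ∩ {x | ∀ j ∉ F, x j = c j}).Nonempty then a i else 0) = 0 by
    simpa using H Finset.univ 0
  intro F
  induction F using Finset.induction_on with
  | empty =>
    intro c
    refine Eq.trans ?_ (h c)
    refine Finset.sum_congr rfl fun i _ => ?_
    have : (K i ∩ {x | ∀ j ∉ (∅ : Finset κ), x j = c j}).Nonempty ↔ c ∈ K i := by
      constructor
      · rintro ⟨x, hx, hxc⟩
        rwa [← show x = c from funext fun j => hxc j (Finset.notMem_empty j)]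
      · exact fun hcK => ⟨c, hcK, fun _ _ => rfl⟩
    by_cases hi : c ∈ K i
    · rw [if_pos (this.mpr hi)]; simp [hi]
    · rw [if_neg (this.not.mpr hi)]; simp [hi]
  | insert k F hk ih =>
    intro c
    have hcl : IsClosed {x : κ → ℝ | ∀ j ∉ insert k F, x j = c j} := by
      simp only [Set.ofPred_forall]
      exact isClosed_iInter fun j => isClosed_iInter fun _ =>
        isClosed_eq (continuous_apply j) continuous_const
    have hcv : Convex ℝ {x : κ → ℝ | ∀ j ∉ insert k F, x j = c j} := by
      intro x hx y hy p q _ _ hpq j hj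
      simp [hx j hj, hy j hj, ← add_mul, hpq]
    -- Project each slice to the coordinate `k`. A point t lies in the projection iff the slice with
    -- `k` also frozen at t is nonempty, so the induction hypothesis is the relation needed on the
    -- line.
    have key := sum_nonempty_eq_zero_of_real s a
      (fun i => (LinearMap.proj k : (κ → ℝ) →ₗ[ℝ] ℝ) ''
        (K i ∩ {x | ∀ j ∉ insert k F, x j = c j}))
      (fun i hi => ((hc i hi).inter_right hcl).image (continuous_apply k))
      (fun i hi => ((hv i hi).inter hcv).linear_image _) ?_
    · simpa only [Set.image_nonempty] using key
    · intro t
      refine Eq.trans ?_ (ih (Function.update c k t))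
      refine Finset.sum_congr rfl fun i _ => ?_
      have : (K i ∩ {x | ∀ j ∉ F, x j = Function.update c k t j}).Nonempty ↔
          t ∈ (LinearMap.proj k : (κ → ℝ) →ₗ[ℝ] ℝ) ''
            (K i ∩ {x | ∀ j ∉ insert k F, x j = c j}) := by
        constructor
        · rintro ⟨x, hx, hxc⟩
          refine ⟨x, ⟨hx, fun j hj => ?_⟩, ?_⟩
          · rw [Finset.mem_insert, not_or] at hj
            simpa [hj.1] using hxc j hj.2
          · simpa using hxc k hk
        · rintro ⟨x, ⟨hx, hxc⟩, rfl⟩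
          refine ⟨x, hx, fun j hj => ?_⟩
          by_cases hjk : j = k
          · subst hjk; simp
          · simpa [hjk] using hxc j (by simp [hjk, hj])
      by_cases hi : t ∈ (LinearMap.proj k : (κ → ℝ) →ₗ[ℝ] ℝ) ''
            (K i ∩ {x | ∀ j ∉ insert k F, x j = c j})
      · rw [if_pos (this.mpr hi), Set.indicator_of_mem hi]; simp
      · rw [if_neg (this.not.mpr hi), Set.indicator_of_notMem hi]; simp

/-! ### Roots of type B and their signs -/

namespace SignedPerm

variable {n : ℕ}

theorem smul_add' (w : SignedPerm n) (v v' : Fin n → ℝ) : w • (v + v') = w • v + w • v' := by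
  funext i; simp [smul_apply, mul_add]

theorem smul_smul_comm (w : SignedPerm n) (r : ℝ) (v : Fin n → ℝ) :
    w • (r • v) = r • (w • v) := by
  funext i; simp only [smul_apply, Pi.smul_apply, smul_eq_mul]; ring

/-- The action of a signed permutation as a linear map. -/
noncomputable def toLinearMap (w : SignedPerm n) : (Fin n → ℝ) →ₗ[ℝ] (Fin n → ℝ) where
  toFun v := w • v
  map_add' := smul_add' w
  map_smul' := smul_smul_comm w

theorem smul_sub' (w : SignedPerm n) (v v' : Fin n → ℝ) : w • (v - v') = w • v - w • v' :=
  map_sub (toLinearMap w) v v'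

theorem smul_single (w : SignedPerm n) (i : Fin n) (x : ℝ) :
    w • (Pi.single i x : Fin n → ℝ) =
      Pi.single (w.right i) (((w.left (w.right i) : ℤˣ) : ℤ) * x) := by
  funext k
  rw [smul_apply]
  by_cases h : k = w.right i
  · subst h; simp
  · have : w.right⁻¹ k ≠ i := fun h' => h (by rw [← h']; simp)
    rw [Pi.single_eq_of_ne h, Pi.single_eq_of_ne this, mul_zero]

theorem unit_mul_self (ε : ℤˣ) : ((ε : ℤ) : ℝ) * ((ε : ℤ) : ℝ) = 1 := by
  rcases Int.units_eq_one_or ε with h | h <;> simp [h]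

theorem smul_dotProduct_smul (w : SignedPerm n) (v v' : Fin n → ℝ) :
    (w • v) ⬝ᵥ (w • v') = v ⬝ᵥ v' := by
  simp only [dotProduct, smul_apply]
  rw [← Equiv.sum_comp w.right⁻¹ fun i => v i * v' i]
  refine Finset.sum_congr rfl fun i _ => ?_
  linear_combination (v (w.right⁻¹ i) * v' (w.right⁻¹ i)) * unit_mul_self (w.left i)

theorem eq_of_smul_eq {w w' : SignedPerm n} (h : ∀ v : Fin n → ℝ, w • v = w' • v) : w = w' := by
  have key : ∀ i, w.left i = w'.left i ∧ w.right⁻¹ i = w'.right⁻¹ i := by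
    intro i
    -- The test vector (1, …, n) has distinct positive entries, so its image reveals both the signs
    -- and the permutation.
    have h1 := congrFun (h fun j => (j : ℝ) + 1) i
    simp only [smul_apply] at h1
    have p1 : (0 : ℝ) ≤ (w.right⁻¹ i : ℕ) := Nat.cast_nonneg _
    have p2 : (0 : ℝ) ≤ (w'.right⁻¹ i : ℕ) := Nat.cast_nonneg _
    rcases Int.units_eq_one_or (w.left i) with e | e <;>
    rcases Int.units_eq_one_or (w'.left i) with e' | e' <;>
    simp only [e, e', Units.val_one, Units.val_neg, Int.cast_one, Int.cast_neg] at h1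
    · exact ⟨by rw [e, e'], Fin.ext (by exact_mod_cast (by linarith :
        ((w.right⁻¹ i : ℕ) : ℝ) = (w'.right⁻¹ i : ℕ)))⟩
    · linarith
    · linarith
    · exact ⟨by rw [e, e'], Fin.ext (by exact_mod_cast (by linarith :
        ((w.right⁻¹ i : ℕ) : ℝ) = (w'.right⁻¹ i : ℕ)))⟩
  refine SemidirectProduct.ext (funext fun i => (key i).1) ?_
  exact inv_injective (Equiv.ext fun i => (key i).2)

/-- The orthogonal reflection in the hyperplane perpendicular to `β`. -/
noncomputable def reflect (β v : Fin n → ℝ) : Fin n → ℝ :=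
  v - (2 * (v ⬝ᵥ β) / (β ⬝ᵥ β)) • β

theorem smul_reflect (w : SignedPerm n) (β v : Fin n → ℝ) :
    w • reflect β v = reflect (w • β) (w • v) := by
  rw [reflect, reflect, smul_sub', smul_smul_comm, smul_dotProduct_smul, smul_dotProduct_smul]

theorem reflect_neg (β v : Fin n → ℝ) : reflect (-β) v = reflect β v := by
  simp only [reflect, dotProduct_neg, neg_dotProduct, neg_neg, smul_neg]
  rw [mul_neg, neg_div, neg_smul, neg_neg]

/-- The roots of type `B_n`. -/
def IsRoot (β : Fin n → ℝ) : Prop :=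
  (∃ i, ∃ ε : ℤˣ, β = Pi.single i ((ε : ℤ) : ℝ)) ∨
    ∃ i j, i ≠ j ∧ ∃ ε ε' : ℤˣ, β = Pi.single i ((ε : ℤ) : ℝ) + Pi.single j ((ε' : ℤ) : ℝ)

theorem IsRoot.smul {β : Fin n → ℝ} (h : IsRoot β) (w : SignedPerm n) : IsRoot (w • β) := by
  rcases h with ⟨i, ε, rfl⟩ | ⟨i, j, hij, ε, ε', rfl⟩
  · refine Or.inl ⟨w.right i, w.left (w.right i) * ε, ?_⟩
    rw [smul_single]; push_cast; rfl
  · refine Or.inr ⟨w.right i, w.right j, fun h => hij (w.right.injective h),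
      w.left (w.right i) * ε, w.left (w.right j) * ε', ?_⟩
    rw [smul_add', smul_single, smul_single]; push_cast; rfl

theorem IsRoot.neg {β : Fin n → ℝ} (h : IsRoot β) : IsRoot (-β) := by
  rcases h with ⟨i, ε, rfl⟩ | ⟨i, j, hij, ε, ε', rfl⟩
  · exact Or.inl ⟨i, -ε, by simp [Pi.single_neg]⟩
  · exact Or.inr ⟨i, j, hij, -ε, -ε', by simp [Pi.single_neg]; abel⟩

/-- The coefficients `n, n - 1, …, 1` of the height functional. -/
noncomputable def heightCoeff (i : Fin n) : ℝ := (n : ℝ) - ((i : ℕ) : ℝ)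

/-- A functional that takes the value `1` on all simple roots. -/
noncomputable def height (v : Fin n → ℝ) : ℝ := ∑ i : Fin n, heightCoeff i * v i

theorem height_add (v v' : Fin n → ℝ) : height (v + v') = height v + height v' := by
  simp [height, mul_add, Finset.sum_add_distrib]

theorem height_smul (r : ℝ) (v : Fin n → ℝ) : height (r • v) = r * height v := by
  simp only [height, Pi.smul_apply, smul_eq_mul, Finset.mul_sum]
  exact Finset.sum_congr rfl fun i _ => by ring

theorem height_neg (v : Fin n → ℝ) : height (-v) = -height v := by
  simp [height]

theorem height_single (i : Fin n) (x : ℝ) :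
    height (Pi.single i x : Fin n → ℝ) = heightCoeff i * x := by
  rw [height, Finset.sum_eq_single i]
  · simp
  · intro j _ hj; simp [hj]
  · simp

theorem one_le_heightCoeff (i : Fin n) : 1 ≤ heightCoeff i := by
  have : ((i : ℕ) : ℝ) + 1 ≤ n := by exact_mod_cast i.2
  rw [heightCoeff]; linarith

theorem heightCoeff_lt_iff {i j : Fin n} : heightCoeff i < heightCoeff j ↔ j < i := by
  rw [heightCoeff, heightCoeff, sub_lt_sub_iff_left, Nat.cast_lt, Fin.lt_def]

theorem heightCoeff_injective : Function.Injective (heightCoeff (n := n)) := by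
  intro i j h
  refine le_antisymm (not_lt.mp fun h' => ?_) (not_lt.mp fun h' => ?_)
  · exact (heightCoeff_lt_iff.mpr h').ne h
  · exact (heightCoeff_lt_iff.mpr h').ne' h

theorem IsRoot.height_ne_zero {β : Fin n → ℝ} (h : IsRoot β) : height β ≠ 0 := by
  rcases h with ⟨i, ε, rfl⟩ | ⟨i, j, hij, ε, ε', rfl⟩
  · have := one_le_heightCoeff i
    rcases Int.units_eq_one_or ε with e | e <;>
      simp only [e, height_single, Units.val_one, Units.val_neg, Int.cast_one, Int.cast_neg] <;>
      intro h <;> linarith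
  · have := one_le_heightCoeff i
    have := one_le_heightCoeff j
    have hne := fun h => hij (heightCoeff_injective h)
    rcases Int.units_eq_one_or ε with e | e <;> rcases Int.units_eq_one_or ε' with e' | e' <;>
      simp only [e, e', height_add, height_single, Units.val_one, Units.val_neg, Int.cast_one,
        Int.cast_neg] <;>
      intro h <;> first | linarith | exact hne (by linarith)

/-- Roots of positive height are e_i, e_i + e_j, and e_i - e_j with i < j, with sums 1, 2 and 0. -/
theorem IsRoot.sum_nonneg {β : Fin n → ℝ} (h : IsRoot β) (hp : 0 < height β) : 0 ≤ ∑ i, β i := by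
  rcases h with ⟨i, ε, rfl⟩ | ⟨i, j, hij, ε, ε', rfl⟩
  · have := one_le_heightCoeff i
    rcases Int.units_eq_one_or ε with e | e <;>
      simp only [e, height_single, Units.val_one, Units.val_neg, Int.cast_one, Int.cast_neg,
        Finset.sum_pi_single', Finset.mem_univ, if_true] at hp ⊢ <;>
      linarith
  · have := one_le_heightCoeff i
    have := one_le_heightCoeff j
    rcases Int.units_eq_one_or ε with e | e <;> rcases Int.units_eq_one_or ε' with e' | e' <;>
      simp only [e, e', height_add, height_single, Units.val_one, Units.val_neg, Int.cast_one,
        Int.cast_neg, Pi.add_apply, Finset.sum_add_distrib,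
        Finset.sum_pi_single', Finset.mem_univ, if_true] at hp ⊢ <;>
      linarith

theorem IsRoot.dotProduct_self_pos {β : Fin n → ℝ} (h : IsRoot β) : 0 < β ⬝ᵥ β := by
  have hne : β ≠ 0 := by
    rintro rfl
    exact h.height_ne_zero (by simp [height])
  exact (show 0 ≤ β ⬝ᵥ β from Finset.sum_nonneg fun i _ => mul_self_nonneg _).lt_of_ne fun h0 => hne (dotProduct_self_eq_zero.mp h0.symm)

/-- `α` is the simple root of the simple reflection `s`. -/
def IsSimpleRootOf (s : SignedPerm n) (α : Fin n → ℝ) : Prop :=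
  (∃ i j : Fin n, (i : ℕ) + 1 = j ∧ s = SemidirectProduct.inr (Equiv.swap i j) ∧
    α = Pi.single i 1 + Pi.single j (-1)) ∨
  ∃ i : Fin n, (i : ℕ) + 1 = n ∧ s = SemidirectProduct.inl (Pi.mulSingle i (-1)) ∧
    α = Pi.single i 1

theorem exists_isSimpleRootOf {s : SignedPerm n} (hs : s ∈ simpleReflections n) :
    ∃ α, IsSimpleRootOf s α := by
  rcases hs with ⟨i, j, hij, rfl⟩ | ⟨i, hi, rfl⟩
  · exact ⟨_, Or.inl ⟨i, j, hij, rfl, rfl⟩⟩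
  · exact ⟨_, Or.inr ⟨i, hi, rfl, rfl⟩⟩

theorem IsSimpleRootOf.isRoot {s : SignedPerm n} {α : Fin n → ℝ} (h : IsSimpleRootOf s α) :
    IsRoot α := by
  rcases h with ⟨i, j, hij, rfl, rfl⟩ | ⟨i, hi, rfl, rfl⟩
  · exact Or.inr ⟨i, j, by rintro rfl; omega, 1, -1, by simp⟩
  · exact Or.inl ⟨i, 1, by simp⟩

theorem IsSimpleRootOf.smul_eq {s : SignedPerm n} {α : Fin n → ℝ} (h : IsSimpleRootOf s α)
    (v : Fin n → ℝ) : s • v = reflect α v := by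
  rcases h with ⟨i, j, hij, rfl, rfl⟩ | ⟨i, hi, rfl, rfl⟩
  · have hne : i ≠ j := by rintro rfl; omega
    funext k
    have : (2 * (v i - v j) / (1 + 1)) = v i - v j := by ring
    by_cases hki : k = i
    · subst hki; simp [smul_apply, reflect, hne, hne.symm, ← sub_eq_add_neg, this]
    · by_cases hkj : k = j
      · subst hkj; simp [smul_apply, reflect, hne, hne.symm, ← sub_eq_add_neg, this]
      · simp [smul_apply, reflect, hki, hkj, Equiv.swap_apply_of_ne_of_ne]
  · funext k
    by_cases hki : k = i
    · subst hki; simp [smul_apply, reflect]; ring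
    · simp [smul_apply, reflect, hki]

/-- An adjacent swap reverses the order of only one pair of indices, and the last coordinate has the
smallest height coefficient, so changing its sign cannot make e_i ± e_n negative. Hence a simple
reflection makes no positive root negative except its own. -/
theorem IsSimpleRootOf.eq_of_height {s : SignedPerm n} {α β : Fin n → ℝ}
    (h : IsSimpleRootOf s α) (hβ : IsRoot β) (hp : 0 < height β) (hn : height (s • β) < 0) :
    β = α := by
  rcases h with ⟨a, b, hab, rfl, rfl⟩ | ⟨a, ha, rfl, rfl⟩
  · rcases hβ with ⟨i, ε, rfl⟩ | ⟨i, j, hij, ε, ε', rfl⟩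
    · have := one_le_heightCoeff i
      have := one_le_heightCoeff (Equiv.swap a b i)
      rcases Int.units_eq_one_or ε with e | e <;>
        simp [e, smul_single, height_single] at hp hn <;> linarith
    · have := one_le_heightCoeff i
      have := one_le_heightCoeff (Equiv.swap a b i)
      have := one_le_heightCoeff j
      have := one_le_heightCoeff (Equiv.swap a b j)
      have key : ∀ i j : Fin n, i < j → Equiv.swap a b j < Equiv.swap a b i → i = a ∧ j = b := by
        intro i j h1 h2
        rw [Equiv.swap_apply_def, Equiv.swap_apply_def] at h2
        split_ifs at h2 <;> simp only [Fin.ext_iff, Fin.lt_def] at * <;> omega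
      rcases Int.units_eq_one_or ε with e | e <;> rcases Int.units_eq_one_or ε' with e' | e' <;>
        simp only [e, e', smul_single, smul_add', height_add, height_single,
          SemidirectProduct.right_inr, SemidirectProduct.left_inr, Pi.one_apply, Units.val_one,
          Units.val_neg, Int.cast_one, Int.cast_neg, one_mul] at hp hn ⊢
      · linarith
      · obtain ⟨rfl, rfl⟩ := key i j
          (heightCoeff_lt_iff.mp (by linarith))
          (heightCoeff_lt_iff.mp (by linarith))
        rfl
      · obtain ⟨rfl, rfl⟩ := key j i
          (heightCoeff_lt_iff.mp (by linarith))
          (heightCoeff_lt_iff.mp (by linarith))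
        exact add_comm _ _
      · linarith
  · have hlast : ∀ i : Fin n, i ≠ a → heightCoeff a < heightCoeff i := by
      intro i hi
      have := i.2
      have : (i : ℕ) ≠ a := fun h => hi (Fin.ext h)
      exact heightCoeff_lt_iff.mpr (Fin.lt_def.mpr (by omega))
    rcases hβ with ⟨i, ε, rfl⟩ | ⟨i, j, hij, ε, ε', rfl⟩
    · have := one_le_heightCoeff i
      by_cases hi : i = a
      · subst hi
        rcases Int.units_eq_one_or ε with e | e
        · simp [e]
        · simp [e, height_single] at hp; linarith
      · rcases Int.units_eq_one_or ε with e | e <;>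
          simp [e, smul_single, height_single, hi] at hp hn <;> linarith
    · exfalso
      have := one_le_heightCoeff i
      have := one_le_heightCoeff j
      by_cases hi : i = a
      · subst hi
        have := hlast j hij.symm
        rcases Int.units_eq_one_or ε with e | e <;> rcases Int.units_eq_one_or ε' with e' | e' <;>
          simp [e, e', smul_single, smul_add', height_add, height_single, hij.symm] at hp hn <;>
          linarith
      · have := hlast i hi
        by_cases hj : j = a
        · subst hj
          rcases Int.units_eq_one_or ε with e | e <;>
            rcases Int.units_eq_one_or ε' with e' | e' <;>
            simp [e, e', smul_single, smul_add', height_add, height_single, hij] at hp hn <;>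
            linarith
        · rcases Int.units_eq_one_or ε with e | e <;>
            rcases Int.units_eq_one_or ε' with e' | e' <;>
            simp [e, e', smul_single, smul_add', height_add, height_single, hi, hj] at hp hn <;>
            linarith

theorem IsSimpleRootOf.mul_self {s : SignedPerm n} {α : Fin n → ℝ} (h : IsSimpleRootOf s α) :
    s * s = 1 := by
  rcases h with ⟨i, j, hij, rfl, rfl⟩ | ⟨i, hi, rfl, rfl⟩
  · rw [← map_mul, Equiv.swap_mul_self, map_one]
  · rw [← map_mul, ← Pi.mulSingle_mul]; simp

end SignedPerm

/-! ### Words, strong exchange and the Bruhat order -/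

namespace SignedPerm

variable {n : ℕ}

theorem inr_mem_closure (σ : Equiv.Perm (Fin n)) :
    (SemidirectProduct.inr σ : SignedPerm n) ∈ Subgroup.closure (adjacentSwaps n) := by
  cases n with
  | zero => rw [Subsingleton.elim σ 1, map_one]; exact one_mem _
  | succ m =>
    have h : σ ∈ Submonoid.closure
        (Set.range fun i : Fin m => Equiv.swap i.castSucc i.succ) := by
      rw [Equiv.Perm.mclosure_swap_castSucc_succ]; trivial
    induction h using Submonoid.closure_induction with
    | mem x hx =>
      obtain ⟨i, rfl⟩ := hx
      exact Subgroup.subset_closure ⟨i.castSucc, i.succ, by simp, rfl⟩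
    | one => rw [map_one]; exact one_mem _
    | mul x y _ _ hx hy => rw [map_mul]; exact mul_mem hx hy

/-- Any single sign change is conjugate, by a transposition, to that of the last coordinate. -/
theorem closure_simpleReflections : Subgroup.closure (simpleReflections n) = ⊤ := by
  have hr : ∀ σ : Equiv.Perm (Fin n),
      (SemidirectProduct.inr σ : SignedPerm n) ∈ Subgroup.closure (simpleReflections n) :=
    fun σ => Subgroup.closure_mono Set.subset_union_left (inr_mem_closure σ)
  have hs : ∀ i, ∀ x : ℤˣ, (SemidirectProduct.inl (Pi.mulSingle i x) : SignedPerm n) ∈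
      Subgroup.closure (simpleReflections n) := by
    intro i x
    rcases Int.units_eq_one_or x with rfl | rfl
    · simp
    · have hn := i.pos
      have hl : (SemidirectProduct.inl (Pi.mulSingle ⟨n - 1, by omega⟩ (-1)) : SignedPerm n) ∈
          Subgroup.closure (simpleReflections n) :=
        Subgroup.subset_closure (Or.inr ⟨⟨n - 1, by omega⟩, by simp; omega, rfl⟩)
      have h := mul_mem (mul_mem (hr (Equiv.swap ⟨n - 1, by omega⟩ i)) hl)
        (inv_mem (hr (Equiv.swap ⟨n - 1, by omega⟩ i)))
      rw [← map_inv, ← SemidirectProduct.inl_aut] at h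
      convert h using 2
      funext k
      change _ = (Pi.mulSingle _ (-1) : Fin n → ℤˣ) ((Equiv.swap _ i)⁻¹ k)
      simp only [Pi.mulSingle_apply, Equiv.swap_inv, Equiv.swap_apply_def]
      split_ifs <;> simp_all
  rw [eq_top_iff]
  intro w _
  rw [← SemidirectProduct.inl_left_mul_inr_right w]
  refine mul_mem ?_ (hr _)
  have : w.left = ∏ i, Pi.mulSingle i (w.left i) := (Finset.univ_prod_mulSingle w.left).symm
  rw [this]
  exact Subgroup.mem_comap.mp (Subgroup.prod_mem ((Subgroup.closure (simpleReflections n)).comap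
    SemidirectProduct.inl) fun i _ => Subgroup.mem_comap.mpr (hs i (w.left i)))

theorem exists_word (w : SignedPerm n) :
    ∃ l : List (SignedPerm n), (∀ s ∈ l, s ∈ simpleReflections n) ∧ l.prod = w := by
  have hw : w ∈ (Subgroup.closure (simpleReflections n)).toSubmonoid := by
    rw [closure_simpleReflections]; trivial
  rw [Subgroup.closure_toSubmonoid] at hw
  obtain ⟨l, hl, hp⟩ := Submonoid.exists_list_of_mem_closure hw
  refine ⟨l, fun s hs => (hl s hs).elim id fun h => ?_, hp⟩
  obtain ⟨α, hα⟩ := exists_isSimpleRootOf h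
  have : s⁻¹ = s := by
    rw [inv_eq_iff_mul_eq_one, ← inv_inj, mul_inv_rev, hα.mul_self, inv_one]
  rwa [Set.mem_inv, this] at h

theorem exists_word_length (w : SignedPerm n) :
    ∃ l : List (SignedPerm n), (∀ s ∈ l, s ∈ simpleReflections n) ∧ l.prod = w ∧
      l.length = Cox.length (simpleReflections n) w := by
  obtain ⟨l, hl, hp⟩ := exists_word w
  exact Nat.sInf_mem (s := {k | ∃ l : List (SignedPerm n),
    (∀ s ∈ l, s ∈ simpleReflections n) ∧ l.prod = w ∧ l.length = k}) ⟨_, l, hl, hp, rfl⟩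

/-- The strong exchange condition. -/
theorem exists_word_mul_reflection {t : SignedPerm n} {α : Fin n → ℝ} (hα : IsRoot α)
    (hpos : 0 < height α) (ht : ∀ v, t • v = reflect α v) (l : List (SignedPerm n))
    (hl : ∀ s ∈ l, s ∈ simpleReflections n) (hneg : height (l.prod • α) < 0) :
    ∃ l' : List (SignedPerm n), (∀ s ∈ l', s ∈ simpleReflections n) ∧ l'.prod = l.prod * t ∧
      l'.length < l.length := by
  induction l with
  | nil => rw [List.prod_nil, one_smul] at hneg; exact absurd hpos hneg.not_gt
  | cons s l ih =>
    rw [List.forall_mem_cons] at hl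
    -- Either the root is already negative before `s` acts, and the tail is shortened, or `s` is
    -- what makes it negative. In the latter case the root is the simple root of `s`, so `l.prod * t
    -- = s * l.prod` and the letter `s` cancels.
    rcases (hα.smul l.prod).height_ne_zero.lt_or_gt with h | h
    · obtain ⟨l', h1, h2, h3⟩ := ih hl.2 h
      exact ⟨s :: l', List.forall_mem_cons.mpr ⟨hl.1, h1⟩,
        by rw [List.prod_cons, List.prod_cons, h2, mul_assoc], by simpa using h3⟩
    · obtain ⟨γ, hγ⟩ := exists_isSimpleRootOf hl.1
      rw [List.prod_cons, mul_smul] at hneg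
      have hβ := hγ.eq_of_height (hα.smul l.prod) h hneg
      have hst : l.prod * t = s * l.prod := by
        refine eq_of_smul_eq fun v => ?_
        rw [mul_smul, mul_smul, ht, smul_reflect, hβ, hγ.smul_eq]
      refine ⟨l, hl.2, ?_, by simp⟩
      rw [List.prod_cons, mul_assoc, hst, ← mul_assoc, hγ.mul_self, one_mul]

/-- Otherwise strong exchange, applied to a shortest word for `u`, gives a still shorter word for `u
* t`. -/
theorem height_smul_pos_of_length_lt {u t : SignedPerm n} {α : Fin n → ℝ} (hα : IsRoot α)
    (hpos : 0 < height α) (ht : ∀ v, t • v = reflect α v)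
    (hlt : Cox.length (simpleReflections n) u < Cox.length (simpleReflections n) (u * t)) :
    0 < height (u • α) := by
  refine (hα.smul u).height_ne_zero.lt_or_gt.resolve_left fun hneg => ?_
  obtain ⟨l, hl, hp, hlen⟩ := exists_word_length u
  rw [← hp] at hneg
  obtain ⟨l', h1, h2, h3⟩ := exists_word_mul_reflection hα hpos ht l hl hneg
  have : Cox.length (simpleReflections n) (u * t) ≤ l'.length :=
    Nat.sInf_le ⟨l', h1, by rw [h2, hp], rfl⟩
  omega

theorem exists_root_of_mem_reflections {t : SignedPerm n}
    (ht : t ∈ Cox.reflections (simpleReflections n)) :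
    ∃ α, IsRoot α ∧ 0 < height α ∧ ∀ v : Fin n → ℝ, t • v = reflect α v := by
  obtain ⟨g, s, hs, rfl⟩ := ht
  obtain ⟨α, hα⟩ := exists_isSimpleRootOf hs
  have key : ∀ v : Fin n → ℝ, (g * s * g⁻¹) • v = reflect (g • α) v := by
    intro v
    rw [mul_smul, mul_smul, hα.smul_eq, smul_reflect, smul_inv_smul]
  have hr := hα.isRoot.smul g
  rcases hr.height_ne_zero.lt_or_gt with h | h
  · exact ⟨-(g • α), hr.neg, by rw [height_neg]; linarith, fun v => by rw [reflect_neg, key]⟩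
  · exact ⟨_, hr, h, key⟩

/-- In one step `v < v * t`, with `t` the reflection in a positive root α, the weight drops by r •
(v • α), where r = 2⟨ϖ, α⟩/⟨α, α⟩ ≥ 0 and `v • α` is positive. The coordinate sum drops only weakly;
the height drops strictly unless r = 0, and so can break ties. -/
theorem bruhatLE_weight {u v : SignedPerm n} (h : Cox.BruhatLE (simpleReflections n) u v) :
    ∑ i, (v • weight n) i ≤ ∑ i, (u • weight n) i ∧
      (height (v • weight n) < height (u • weight n) ∨ v • weight n = u • weight n) := by
  induction h with
  | refl => exact ⟨le_rfl, Or.inr rfl⟩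
  | @tail v w _ hvw ih =>
    obtain ⟨t, ht, rfl, hlt⟩ := hvw
    obtain ⟨α, hα, hpos, hrefl⟩ := exists_root_of_mem_reflections ht
    have hv := height_smul_pos_of_length_lt hα hpos hrefl hlt
    have hsum := (hα.smul v).sum_nonneg hv
    obtain ⟨r, hr0, hr⟩ : ∃ r : ℝ, 0 ≤ r ∧
        v • weight n = (v * t) • weight n + r • (v • α) := by
      refine ⟨2 * (weight n ⬝ᵥ α) / (α ⬝ᵥ α), ?_, ?_⟩
      · refine div_nonneg (mul_nonneg zero_le_two ?_) hα.dotProduct_self_pos.le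
        simp only [dotProduct, weight, ← Finset.mul_sum]
        exact mul_nonneg (by norm_num) (hα.sum_nonneg hpos)
      · rw [mul_smul, hrefl, reflect, smul_sub', smul_smul_comm, sub_add_cancel]
    have h1 : ∑ i, (v • weight n) i = ∑ i, ((v * t) • weight n) i + r * ∑ i, (v • α) i := by
      rw [Finset.mul_sum, ← Finset.sum_add_distrib]
      exact Finset.sum_congr rfl fun i _ => congrFun hr i
    refine ⟨by nlinarith [mul_nonneg hr0 hsum], ?_⟩
    rcases hr0.eq_or_lt with rfl | hr0
    · rw [zero_smul, add_zero] at hr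
      rw [← hr]; exact ih.2
    · left
      have h2 := congrArg height hr
      rw [height_add, height_smul] at h2
      have := mul_pos hr0 hv
      rcases ih.2 with h3 | h3
      · linarith
      · rw [h3] at h2; linarith

theorem mem_closure_of_smul_weight {w : SignedPerm n} (h : w • weight n = weight n) :
    w ∈ Subgroup.closure (adjacentSwaps n) := by
  have : w.left = 1 := by
    funext i
    have := congrFun h i
    rw [smul_apply] at this
    rcases Int.units_eq_one_or (w.left i) with e | e
    · rw [e]; rfl
    · rw [e] at this; simp [weight] at this; norm_num at this
  rw [← SemidirectProduct.inl_left_mul_inr_right w, this, map_one, one_mul]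
  exact inr_mem_closure _

end SignedPerm

/-! ### The minimal basis minimises the defect -/

namespace DeltaMatroid

variable {n : ℕ}

open SignedPerm

theorem delta_mk (u : SignedPerm n) : delta (u : Basis n) = u • weight n := rfl

theorem delta_smul (w : SignedPerm n) (B : Basis n) : delta (w • B) = w • delta B := by
  induction B using QuotientGroup.induction_on with
  | H u => exact mul_smul w u (weight n)

theorem delta_injective : Function.Injective (delta (n := n)) := by
  intro B B' h
  induction B using QuotientGroup.induction_on with
  | H u =>
    induction B' using QuotientGroup.induction_on with
    | H v =>
      rw [delta_mk, delta_mk] at h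
      refine QuotientGroup.eq.mpr (mem_closure_of_smul_weight ?_)
      rw [mul_smul, ← h, inv_smul_smul]

theorem delta_eq (B : Basis n) (i : Fin n) : delta B i = 1 / 2 ∨ delta B i = -(1 / 2) := by
  induction B using QuotientGroup.induction_on with
  | H u =>
    rw [delta_mk, smul_apply]
    rcases Int.units_eq_one_or (u.left i) with e | e <;> simp [e, weight]

/-- The number of negative coordinates of `δ_B`. -/
noncomputable def defect (B : Basis n) : ℕ := (Finset.univ.filter fun i => delta B i < 0).card

theorem defect_eq (B : Basis n) : (defect B : ℝ) = (n : ℝ) / 2 - ∑ i, delta B i := by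
  have h1 : (n : ℝ) / 2 = ∑ _i : Fin n, (1 / 2 : ℝ) := by simp; ring
  rw [defect, Finset.card_filter, h1, ← Finset.sum_sub_distrib]
  push_cast
  refine Finset.sum_congr rfl fun i _ => ?_
  rcases delta_eq B i with h | h <;> rw [h] <;> norm_num

theorem cosetLE_delta {B B' : Basis n}
    (h : Cox.CosetLE (simpleReflections n) (adjacentSwaps n) B B') :
    defect B ≤ defect B' ∧ (height (delta B') < height (delta B) ∨ B = B') := by
  obtain ⟨u, v, rfl, rfl, huv⟩ := h
  obtain ⟨h1, h2⟩ := bruhatLE_weight huv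
  refine ⟨?_, h2.imp id fun h => delta_injective h.symm⟩
  have h3 := defect_eq (u : Basis n)
  have h4 := defect_eq (v : Basis n)
  rw [delta_mk] at h3 h4
  exact_mod_cast (by linarith : (defect (u : Basis n) : ℝ) ≤ defect (v : Basis n))

theorem minBasis_mem (M : DeltaMatroid n) (w : SignedPerm n) : Cox.minBasis M w ∈ M.1 :=
  (M.2 w).choose_spec.1.1

theorem defect_minBasis_le (M : DeltaMatroid n) (w : SignedPerm n) {B : Basis n} (hB : B ∈ M.1) :
    defect (w⁻¹ • Cox.minBasis M w) ≤ defect (w⁻¹ • B) := by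
  -- A lexicographic minimiser of (defect, -height) is `≤^w`-minimal, because any strictly smaller
  -- basis has no larger defect and strictly larger height. Uniqueness of the minimal element then
  -- makes it `minBasis M w`.
  let f : Basis n → ℕ ×ₗ ℝ := fun B => toLex (defect (w⁻¹ • B), -height (delta (w⁻¹ • B)))
  obtain ⟨C, hC, hmin⟩ := Set.exists_min_image M.1 f (Set.toFinite _) ⟨B, hB⟩
  have hCmin : Cox.IsMinimalIn (simpleReflections n) (adjacentSwaps n) w M.1 C := by
    refine ⟨hC, fun D hD hle => ?_⟩
    obtain ⟨h1, h2⟩ := cosetLE_delta hle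
    refine h2.elim (fun h2 => ?_) fun h2 => smul_left_cancel _ h2
    have h3 := hmin D hD
    rw [Prod.Lex.toLex_le_toLex] at h3
    rcases h3 with h3 | ⟨-, h3⟩
    · exact absurd h3 h1.not_gt
    · exact absurd h2 (by simpa using h3)
  have heq : Cox.minBasis M w = C := ((M.2 w).choose_spec.2 C hCmin).symm
  rw [heq]
  have h3 := hmin B hB
  rw [Prod.Lex.toLex_le_toLex] at h3
  rcases h3 with h3 | ⟨h3, -⟩
  · exact h3.le
  · exact h3.le

end DeltaMatroid

/-! ### The formula for the interlace polynomial -/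

namespace DeltaMatroid

variable {n : ℕ}

open SignedPerm

theorem posSet_mk (w : SignedPerm n) :
    posSet (w : Basis n) = Finset.univ.filter fun i => w.left i = 1 := by
  ext i
  rw [posSet, Finset.mem_filter, Finset.mem_filter, delta_mk, smul_apply]
  rcases Int.units_eq_one_or (w.left i) with e | e <;> simp [e, weight]

/-- `posSet` sees only the signs, which biject with subsets; the permutation contributes the factor
n!. -/
theorem sum_posSet {R : Type*} [AddCommMonoid R] (F : Finset (Fin n) → R) :
    ∑ w : SignedPerm n, F (posSet (w : Basis n)) = n.factorial • ∑ A, F A := by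
  simp only [posSet_mk]
  rw [← Equiv.sum_comp SemidirectProduct.equivProd.symm, Fintype.sum_prod_type_right]
  have h : ∑ ε : Fin n → ℤˣ, F (Finset.univ.filter fun i => ε i = 1) = ∑ A, F A := by
    refine Finset.sum_bij' (fun ε _ => Finset.univ.filter fun i => ε i = 1)
      (fun A _ i => if i ∈ A then 1 else -1) (by simp) (by simp) ?_ ?_ (by simp)
    · intro ε _
      funext i
      rcases Int.units_eq_one_or (ε i) with e | e <;> simp [e]
    · intro A _
      ext i
      by_cases hi : i ∈ A <;> simp [hi]
  rw [← h]
  change ∑ _σ : Equiv.Perm (Fin n), ∑ ε : Fin n → ℤˣ,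
    F (Finset.univ.filter fun i => ε i = 1) = _
  rw [Finset.sum_const, Finset.card_univ, Fintype.card_perm, Fintype.card_fin]

/-- The affine function with value `defect (u⁻¹ • B)` at `δ_B`. -/
noncomputable def defectFun (u : SignedPerm n) (v : Fin n → ℝ) : ℝ :=
  (n : ℝ) / 2 - ∑ i, (u⁻¹ • v) i

theorem defectFun_delta (u : SignedPerm n) (B : Basis n) :
    defectFun u (delta B) = defect (u⁻¹ • B) := by
  rw [defectFun, defect_eq, delta_smul]

theorem defectFun_smul (u w : SignedPerm n) (v : Fin n → ℝ) :
    defectFun u (w • v) = defectFun (w⁻¹ * u) v := by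
  rw [defectFun, defectFun, smul_smul, mul_inv_rev, inv_inv]

/-- As `u` is an isometry and ϖ = (1/2, …, 1/2), the coordinate sum of u⁻¹δ_B is 2⟨δ_B, δ_u⟩. A
coordinate then contributes 1/2 - 2(±1/4), which is 0 where the signs agree and 1 where they differ.
-/
theorem card_symmDiff_posSet (u : SignedPerm n) (B : Basis n) :
    ((posSet B \ posSet (u : Basis n)) ∪ (posSet (u : Basis n) \ posSet B)).card =
      defect (u⁻¹ • B) := by
  have h1 : ∑ i, (u⁻¹ • delta B) i = 2 * (delta B ⬝ᵥ delta (u : Basis n)) := by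
    rw [← smul_dotProduct_smul u⁻¹, delta_mk, inv_smul_smul, dotProduct, Finset.mul_sum]
    exact Finset.sum_congr rfl fun i _ => by rw [weight]; ring
  have h2 : (n : ℝ) / 2 = ∑ _i : Fin n, (1 / 2 : ℝ) := by simp; ring
  have h3 : (posSet B \ posSet (u : Basis n)) ∪ (posSet (u : Basis n) \ posSet B) =
      Finset.univ.filter fun i => ¬ (0 < delta B i ↔ 0 < delta (u : Basis n) i) := by
    ext i
    simp only [posSet, Finset.mem_union, Finset.mem_sdiff, Finset.mem_filter, Finset.mem_univ,
      true_and]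
    tauto
  have key : ((((posSet B \ posSet (u : Basis n)) ∪ (posSet (u : Basis n) \ posSet B)).card : ℕ)
      : ℝ) = defect (u⁻¹ • B) := by
    rw [defect_eq, delta_smul, h1, h2, h3, Finset.card_filter, dotProduct, Finset.mul_sum,
      ← Finset.sum_sub_distrib]
    push_cast
    refine Finset.sum_congr rfl fun i _ => ?_
    rcases delta_eq B i with h | h <;> rcases delta_eq (u : Basis n) i with h' | h' <;>
      rw [h, h'] <;> norm_num
  exact_mod_cast key

theorem dist_posSet (M : DeltaMatroid n) (u : SignedPerm n) :
    dist M (posSet (u : Basis n)) = defect (u⁻¹ • Cox.minBasis M u) := by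
  refine le_antisymm (Nat.sInf_le ⟨_, minBasis_mem M u, (card_symmDiff_posSet u _).symm⟩) ?_
  refine le_csInf ⟨_, _, minBasis_mem M u, rfl⟩ ?_
  rintro _ ⟨B, hB, rfl⟩
  rw [card_symmDiff_posSet]
  exact defect_minBasis_le M u hB

theorem interlace_eq (M : DeltaMatroid n) :
    interlace M = C (1 / (n.factorial : ℚ)) *
      ∑ w : SignedPerm n, X ^ defect (w⁻¹ • Cox.minBasis M w) := by
  have h : (n.factorial : ℚ) ≠ 0 := Nat.cast_ne_zero.mpr n.factorial_ne_zero
  simp only [← dist_posSet]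
  rw [sum_posSet fun A => (X : ℚ[X]) ^ dist M A, nsmul_eq_mul, ← mul_assoc, interlace,
    ← C_eq_natCast, ← C_mul, one_div_mul_cancel h, C_1, one_mul]

/-! ### Half-spaces and valuativity -/

theorem isLinearMap_sum_smul (u : SignedPerm n) :
    IsLinearMap ℝ fun v : Fin n → ℝ => ∑ i, (u⁻¹ • v) i where
  map_add v v' := by simp [smul_add', Finset.sum_add_distrib]
  map_smul r v := by simp [smul_smul_comm, Finset.mul_sum]

theorem convex_setOf_defectFun_le (u : SignedPerm n) (k : ℝ) :
    Convex ℝ {v : Fin n → ℝ | defectFun u v ≤ k} := by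
  simp only [defectFun, sub_le_comm (α := ℝ)]
  exact convex_halfSpace_ge (isLinearMap_sum_smul u) ((n : ℝ) / 2 - k)

theorem convex_setOf_le_defectFun (u : SignedPerm n) (k : ℝ) :
    Convex ℝ {v : Fin n → ℝ | k ≤ defectFun u v} := by
  simp only [defectFun, le_sub_comm (a := k) (α := ℝ)]
  exact convex_halfSpace_le (isLinearMap_sum_smul u) ((n : ℝ) / 2 - k)

theorem isClosed_setOf_defectFun_le (u : SignedPerm n) (k : ℝ) :
    IsClosed {v : Fin n → ℝ | defectFun u v ≤ k} := by
  have h : Continuous (defectFun u) := by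
    unfold defectFun
    simp only [smul_apply]
    fun_prop
  exact isClosed_le h continuous_const

/-- An affine function on a convex hull is bounded below by its minimum on the generating points.
This expresses the minimal defect through the polytope alone, as both valuativity and invariance
require. -/
theorem basePolytope_inter_nonempty (M : DeltaMatroid n) (u : SignedPerm n) (k : ℕ) :
    (basePolytope M ∩ {v | defectFun u v ≤ k}).Nonempty ↔
      defect (u⁻¹ • Cox.minBasis M u) ≤ k := by
  constructor
  · rintro ⟨v, hv, hk⟩
    have hsub : basePolytope M ⊆
        {v | (defect (u⁻¹ • Cox.minBasis M u) : ℝ) ≤ defectFun u v} := by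
      refine convexHull_min ?_ (convex_setOf_le_defectFun u _)
      rintro _ ⟨B, hB, rfl⟩
      rw [Set.mem_ofPred_eq, defectFun_delta]
      exact_mod_cast defect_minBasis_le M u hB
    have hv' := hsub hv
    rw [Set.mem_ofPred_eq] at hv' hk
    exact_mod_cast hv'.trans hk
  · intro h
    refine ⟨delta (Cox.minBasis M u),
      subset_convexHull ℝ _ ⟨_, minBasis_mem M u, rfl⟩, ?_⟩
    rw [Set.mem_ofPred_eq, defectFun_delta]
    exact_mod_cast h

theorem isCompact_basePolytope (M : DeltaMatroid n) : IsCompact (basePolytope M) :=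
  ((Set.toFinite M.1).image delta).isCompact_convexHull ℝ

/-- The relation survives multiplication by the indicator of a half-space; the Euler characteristic
then applies to the truncated polytopes. -/
theorem sum_ite_defect_le (s : Finset (DeltaMatroid n)) (a : DeltaMatroid n → ℤ)
    (h : ∑ M ∈ s, a M • (basePolytope M).indicator (fun _ => (1 : ℤ)) = 0)
    (u : SignedPerm n) (k : ℕ) :
    ∑ M ∈ s, (if defect (u⁻¹ • Cox.minBasis M u) ≤ k then a M else 0) = 0 := by
  classical
  have key := sum_nonempty_eq_zero s a
    (fun M => basePolytope M ∩ {v | defectFun u v ≤ k})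
    (fun M _ => (isCompact_basePolytope M).inter_right (isClosed_setOf_defectFun_le u k))
    (fun M _ => (convex_convexHull ℝ _).inter (convex_setOf_defectFun_le u k)) ?_
  · simpa only [basePolytope_inter_nonempty] using key
  · intro x
    by_cases hx : x ∈ {v | defectFun u v ≤ (k : ℝ)}
    · have h1 := congrFun h x
      rw [Finset.sum_apply] at h1
      refine Eq.trans (Finset.sum_congr rfl fun M _ => ?_) h1
      by_cases hM : x ∈ basePolytope M
      · rw [Set.indicator_of_mem (Set.mem_inter hM hx)]; simp [hM]
      · rw [Set.indicator_of_notMem fun h => hM h.1]; simp [hM]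
    · refine Finset.sum_eq_zero fun M _ => ?_
      rw [Set.indicator_of_notMem fun h => hx h.2, mul_zero]

theorem sum_ite_defect_eq (s : Finset (DeltaMatroid n)) (a : DeltaMatroid n → ℤ)
    (h : ∑ M ∈ s, a M • (basePolytope M).indicator (fun _ => (1 : ℤ)) = 0)
    (u : SignedPerm n) (k : ℕ) :
    ∑ M ∈ s, (if k = defect (u⁻¹ • Cox.minBasis M u) then a M else 0) = 0 := by
  cases k with
  | zero =>
    refine Eq.trans (Finset.sum_congr rfl fun M _ => ?_) (sum_ite_defect_le s a h u 0)
    simp only [Nat.le_zero, eq_comm]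
  | succ k =>
    -- Subtracting consecutive thresholds isolates defect exactly k + 1.
    have h1 := congrArg₂ (· - ·) (sum_ite_defect_le s a h u (k + 1))
      (sum_ite_defect_le s a h u k)
    rw [sub_self, ← Finset.sum_sub_distrib] at h1
    refine Eq.trans (Finset.sum_congr rfl fun M _ => ?_) h1
    split_ifs <;> omega

theorem isValuative_interlace :
    IsValuative (basePolytope (n := n)) (interlace (n := n)) := by
  intro s a h
  simp only [interlace_eq, ← mul_smul_comm]
  rw [← Finset.mul_sum]
  simp only [Finset.smul_sum]
  rw [Finset.sum_comm, Finset.sum_eq_zero, mul_zero]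
  -- The relation holds already for each `u` separately, coefficient by coefficient.
  intro u _
  ext k
  rw [finsetSum_coeff, coeff_zero]
  have := congrArg (Int.cast (R := ℚ)) (sum_ite_defect_eq s a h u k)
  rw [Int.cast_sum, Int.cast_zero] at this
  rw [← this]
  refine Finset.sum_congr rfl fun M _ => ?_
  rw [coeff_smul, coeff_X_pow]
  split_ifs <;> simp

/-! ### Invariance under W -/

/-- The translate `w M` of a delta-matroid. -/
noncomputable def translate (w : SignedPerm n) (M : DeltaMatroid n) : DeltaMatroid n := by
  refine ⟨(fun B => w • B) '' M.1, fun w' => ?_⟩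
  have key : ∀ B, Cox.IsMinimalIn (simpleReflections n) (adjacentSwaps n) w'
      ((fun B => w • B) '' M.1) (w • B) ↔
      Cox.IsMinimalIn (simpleReflections n) (adjacentSwaps n) (w⁻¹ * w') M.1 B := by
    intro B
    rw [Cox.IsMinimalIn, Cox.IsMinimalIn, Set.forall_mem_image,
      (MulAction.injective w).mem_set_image]
    simp only [Cox.ShiftedLE, mul_inv_rev, inv_inv, mul_smul, smul_left_cancel_iff]
  obtain ⟨B, hB, huniq⟩ := M.2 (w⁻¹ * w')
  refine ⟨w • B, (key B).mpr hB, fun C hC => ?_⟩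
  obtain ⟨D, rfl⟩ : ∃ D, w • D = C := ⟨w⁻¹ • C, smul_inv_smul _ _⟩
  rw [huniq D ((key D).mp hC)]

theorem basePolytope_translate (w : SignedPerm n) (M : DeltaMatroid n) :
    basePolytope (translate w M) = (fun v => w • v) '' basePolytope M := by
  change convexHull ℝ (delta '' ((fun B => w • B) '' M.1)) =
    toLinearMap w '' convexHull ℝ (delta '' M.1)
  rw [LinearMap.image_convexHull, Set.image_image, Set.image_image]
  simp only [delta_smul]
  rfl

/-- A natural number is determined by which k bound it from above, and `w⁻¹` carries the half-spaces
of `u` to those of `w⁻¹ * u`. -/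
theorem defect_minBasis_of_basePolytope_eq {w : SignedPerm n} {M N : DeltaMatroid n}
    (h : basePolytope N = (fun v => w • v) '' basePolytope M) (u : SignedPerm n) :
    defect (u⁻¹ • Cox.minBasis N u) = defect ((w⁻¹ * u)⁻¹ • Cox.minBasis M (w⁻¹ * u)) := by
  refine eq_of_forall_ge_iff fun k => ?_
  rw [← basePolytope_inter_nonempty, ← basePolytope_inter_nonempty, h]
  constructor
  · rintro ⟨_, ⟨v, hv, rfl⟩, hk⟩
    exact ⟨v, hv, by rwa [Set.mem_ofPred_eq, ← defectFun_smul]⟩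
  · rintro ⟨v, hv, hk⟩
    exact ⟨w • v, ⟨v, hv, rfl⟩, by rwa [Set.mem_ofPred_eq, defectFun_smul]⟩

theorem interlace_of_basePolytope_eq {w : SignedPerm n} {M N : DeltaMatroid n}
    (h : basePolytope N = (fun v => w • v) '' basePolytope M) : interlace N = interlace M := by
  rw [interlace_eq, interlace_eq]
  simp only [defect_minBasis_of_basePolytope_eq h]
  rw [← Equiv.sum_comp (Equiv.mulLeft w⁻¹)
    fun u : SignedPerm n => (X : ℚ[X]) ^ defect (u⁻¹ • Cox.minBasis M u)]
  rfl

end DeltaMatroid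

theorem mainTheorem7 (n : ℕ) :
    ∃ e : DeltaMatroid.Basis n → ℕ,
      (∀ B, (e B : ℝ) = (n : ℝ) / 2 - ∑ i, DeltaMatroid.delta B i) ∧
      (∀ M : DeltaMatroid n,
        DeltaMatroid.interlace M =
          Polynomial.C (1 / (n.factorial : ℚ)) *
            ∑ w : SignedPerm n, Polynomial.X ^ e (w⁻¹ • Cox.minBasis M w)) ∧
      (∃ ψ : (DeltaMatroid.Basis n → ℚ) →ₗ[ℚ] Polynomial ℚ,
        (∀ B, ψ (Cox.U B) = Polynomial.C (1 / (n.factorial : ℚ)) * Polynomial.X ^ e B) ∧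
        ∀ M : DeltaMatroid n, ψ (Cox.GInvariant M) = DeltaMatroid.interlace M) ∧
      IsValuativeInvariant (SignedPerm n) (DeltaMatroid.basePolytope (n := n))
        (DeltaMatroid.interlace (n := n)) := by
  classical
  refine ⟨DeltaMatroid.defect, DeltaMatroid.defect_eq, DeltaMatroid.interlace_eq, ?_,
    DeltaMatroid.isValuative_interlace,
    fun w M => ⟨_, DeltaMatroid.basePolytope_translate w M⟩,
    fun _ _ _ h => DeltaMatroid.interlace_of_basePolytope_eq h⟩
  have := Fintype.ofFinite (DeltaMatroid.Basis n)
  let ψ : (DeltaMatroid.Basis n → ℚ) →ₗ[ℚ] Polynomial ℚ :=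
    (Pi.basisFun ℚ (DeltaMatroid.Basis n)).constr ℚ fun B =>
      Polynomial.C (1 / (n.factorial : ℚ)) * Polynomial.X ^ DeltaMatroid.defect B
  have hψ : ∀ B, ψ (Cox.U B) =
      Polynomial.C (1 / (n.factorial : ℚ)) * Polynomial.X ^ DeltaMatroid.defect B := by
    intro B
    rw [← (Pi.basisFun ℚ (DeltaMatroid.Basis n)).constr_basis ℚ (fun B =>
      Polynomial.C (1 / (n.factorial : ℚ)) * Polynomial.X ^ DeltaMatroid.defect B) B,
      Pi.basisFun_apply]
    congr
  refine ⟨ψ, hψ, fun M => ?_⟩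
  rw [Cox.GInvariant, map_sum, DeltaMatroid.interlace_eq, Finset.mul_sum]
  exact Finset.sum_congr rfl fun w _ => hψ _
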